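/- Let $n>1$ and let $\mathbb{D}^n$ be the open unit polydisc in $\mathbb{C}^n$, $\mathbb{T}^n$ the unit torus and $m$ its normalized Lebesgue measure. Let $H^2(\mathbb{D}^n)$ be the space of all holomorphic functions $f$ on $\mathbb{D}^n$ with $$\sup_{0\le r_1,\dots,r_n<1}\int_{\mathbb{T}^n}|f(r_1w_1,\dots,r_nw_n)|^2\,dm(w)<\infty .$$ Let $\varphi$ and $\psi$ be inner functions on $\mathbb{D}^n$, that is, bounded holomorphic functions on $\mathbb{D}^n$ whose radial limits $\lim_{r\to1^-}\varphi(rw)$ and $\lim_{r\to1^-}\psi(rw)$ have modulus one for almost every $w\in\mathbb{T}^n$. If $$\dim\Bigl(H^2(\mathbb{D}^n)\big/\bigl(\varphi H^2(\mathbb{D}^n)+\psi H^2(\mathbb{D}^n)\bigr)\Bigr)<\infty ,$$ then $$\varphi H^2(\mathbb{D}^n)\cap\psi H^2(\mathbb{D}^n)=\varphi\psi H^2(\mathbb{D}^n).$$ -/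

import Mathlib

open MeasureTheory Filter Topology
open scoped ENNReal

namespace HardyPolydisc

/-- The open unit polydisc `𝔻ⁿ` in `ℂⁿ`. -/
def polydisc (n : ℕ) : Set (Fin n → ℂ) := {z | ∀ i, ‖z i‖ < 1}

/-- Normalized Lebesgue measure `m` on the torus, written as `(ℝ/ℤ)ⁿ`: the product of the Haar
probability measures on the circles. -/
noncomputable def torusMeasure (n : ℕ) : Measure (UnitAddTorus (Fin n)) :=
  Measure.pi fun _ => AddCircle.haarAddCircle

/-- The point `(r₁ w₁, …, rₙ wₙ)`, where `w = (e^{2πiθ₁}, …, e^{2πiθₙ})` runs through the torus `𝕋ⁿ`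
as `θ` runs through `(ℝ/ℤ)ⁿ`. -/
noncomputable def torusPoint {n : ℕ} (r : Fin n → ℝ) (θ : UnitAddTorus (Fin n)) : Fin n → ℂ :=
  fun i => (r i : ℂ) * ((θ i).toCircle : ℂ)

/-- Extension by zero of a function on `𝔻ⁿ` to `ℂⁿ`; only its values on `𝔻ⁿ` are ever relevant. -/
noncomputable def zeroExt {n : ℕ} (f : polydisc n → ℂ) : (Fin n → ℂ) → ℂ :=
  Function.extend Subtype.val f 0

/-- `f` is holomorphic on `𝔻ⁿ` (complex differentiable at every point of this open set). -/
def IsHolomorphic {n : ℕ} (f : polydisc n → ℂ) : Prop :=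
  DifferentiableOn ℂ (zeroExt f) (polydisc n)

/-- The quantity `sup_{0 ≤ r₁, …, rₙ < 1} ∫_{𝕋ⁿ} |f(r₁ w₁, …, rₙ wₙ)|² dm(w)`, in `[0, ∞]`. -/
noncomputable def hardyMean {n : ℕ} (f : polydisc n → ℂ) : ℝ≥0∞ :=
  ⨆ r ∈ {r : Fin n → ℝ | ∀ i, 0 ≤ r i ∧ r i < 1},
    ∫⁻ θ : UnitAddTorus (Fin n), ‖zeroExt f (torusPoint r θ)‖ₑ ^ 2 ∂torusMeasure n

theorem zeroExt_apply {n : ℕ} (f : polydisc n → ℂ) (z : polydisc n) : zeroExt f z = f z :=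
  Subtype.val_injective.extend_apply f 0 z

theorem zeroExt_apply_of_mem {n : ℕ} (f : polydisc n → ℂ) {z : Fin n → ℂ} (hz : z ∈ polydisc n) :
    zeroExt f z = f ⟨z, hz⟩ :=
  zeroExt_apply f ⟨z, hz⟩

theorem torusPoint_mem {n : ℕ} {r : Fin n → ℝ} (hr : ∀ i, 0 ≤ r i ∧ r i < 1)
    (θ : UnitAddTorus (Fin n)) : torusPoint r θ ∈ polydisc n := by
  intro i
  have h : ‖torusPoint r θ i‖ = r i := by
    rw [torusPoint, norm_mul, Circle.norm_coe, mul_one, Complex.norm_real,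
      Real.norm_of_nonneg (hr i).1]
  rw [h]
  exact (hr i).2

theorem continuous_torusPoint {n : ℕ} (r : Fin n → ℝ) :
    Continuous (torusPoint r : UnitAddTorus (Fin n) → Fin n → ℂ) := by
  refine continuous_pi fun i => continuous_const.mul ?_
  exact continuous_subtype_val.comp (AddCircle.continuous_toCircle.comp (continuous_apply i))

theorem IsHolomorphic.continuous_torus {n : ℕ} {f : polydisc n → ℂ} (hf : IsHolomorphic f)
    {r : Fin n → ℝ} (hr : ∀ i, 0 ≤ r i ∧ r i < 1) :
    Continuous fun θ : UnitAddTorus (Fin n) => zeroExt f (torusPoint r θ) :=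
  hf.continuousOn.comp_continuous (continuous_torusPoint r) fun θ => torusPoint_mem hr θ

theorem hardyMean_add_lt {n : ℕ} {f g : polydisc n → ℂ} (hf : IsHolomorphic f)
    (hf' : hardyMean f < ∞) (hg' : hardyMean g < ∞) : hardyMean (f + g) < ∞ := by
  refine lt_of_le_of_lt (b := 2 * hardyMean f + 2 * hardyMean g) ?_
    (ENNReal.add_lt_top.2 ⟨ENNReal.mul_lt_top (by simp) hf', ENNReal.mul_lt_top (by simp) hg'⟩)
  refine iSup₂_le fun r hr => ?_
  have h1 : ∀ θ : UnitAddTorus (Fin n), ‖zeroExt (f + g) (torusPoint r θ)‖ₑ ^ 2 ≤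
      2 * ‖zeroExt f (torusPoint r θ)‖ₑ ^ 2 + 2 * ‖zeroExt g (torusPoint r θ)‖ₑ ^ 2 := by
    intro θ
    simp only [zeroExt_apply_of_mem _ (torusPoint_mem hr θ), Pi.add_apply]
    generalize f _ = a
    generalize g _ = b
    simp only [enorm_eq_nnnorm]
    norm_cast
    rw [← NNReal.coe_le_coe]
    push_cast
    have := norm_add_le a b
    nlinarith [norm_nonneg (a + b), sq_nonneg (‖a‖ - ‖b‖), norm_nonneg a, norm_nonneg b]
  have hm : Measurable fun θ : UnitAddTorus (Fin n) => ‖zeroExt f (torusPoint r θ)‖ₑ ^ 2 :=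
    ((hf.continuous_torus hr).measurable.enorm).pow_const 2
  calc _ ≤ _ := lintegral_mono h1
    _ = 2 * (∫⁻ θ : UnitAddTorus (Fin n), ‖zeroExt f (torusPoint r θ)‖ₑ ^ 2 ∂torusMeasure n) +
        2 * (∫⁻ θ : UnitAddTorus (Fin n), ‖zeroExt g (torusPoint r θ)‖ₑ ^ 2 ∂torusMeasure n) := by
      rw [lintegral_add_left (hm.const_mul 2), lintegral_const_mul' _ _ (by simp),
        lintegral_const_mul' _ _ (by simp)]
    _ ≤ _ := by
      gcongr
      · exact le_iSup₂_of_le r hr le_rfl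
      · exact le_iSup₂_of_le r hr le_rfl

/-- The Hardy space `H²(𝔻ⁿ)`: holomorphic functions on `𝔻ⁿ` with bounded quadratic means over the
tori, as a linear subspace of the space of all complex functions on `𝔻ⁿ`. -/
noncomputable def H2 (n : ℕ) : Submodule ℂ (polydisc n → ℂ) where
  carrier := {f | IsHolomorphic f ∧ hardyMean f < ∞}
  zero_mem' := by
    refine ⟨(differentiableOn_const (0 : ℂ)).congr fun z hz => ?_, ?_⟩
    · simp [zeroExt_apply_of_mem _ hz]
    · refine lt_of_le_of_lt (iSup₂_le fun r hr => ?_) ENNReal.zero_lt_top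
      simp [zeroExt_apply_of_mem _ (torusPoint_mem hr _)]
  add_mem' := by
    rintro f g ⟨hf, hf'⟩ ⟨hg, hg'⟩
    refine ⟨(DifferentiableOn.add hf hg).congr fun z hz => ?_, hardyMean_add_lt hf hf' hg'⟩
    simp [zeroExt_apply_of_mem _ hz]
  smul_mem' := by
    rintro c f ⟨hf, hf'⟩
    refine ⟨(DifferentiableOn.const_smul hf c).congr fun z hz => ?_, ?_⟩
    · simp [zeroExt_apply_of_mem _ hz]
    · refine lt_of_le_of_lt (b := ‖c‖ₑ ^ 2 * hardyMean f) (iSup₂_le fun r hr => ?_)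
        (ENNReal.mul_lt_top (by simp) hf')
      have h : ∀ θ : UnitAddTorus (Fin n), ‖zeroExt (c • f) (torusPoint r θ)‖ₑ ^ 2 =
          ‖c‖ₑ ^ 2 * ‖zeroExt f (torusPoint r θ)‖ₑ ^ 2 := by
        intro θ
        simp [zeroExt_apply_of_mem _ (torusPoint_mem hr θ), mul_pow]
      simp only [h]
      rw [lintegral_const_mul' _ _ (by simp)]
      gcongr
      exact le_iSup₂_of_le r hr le_rfl

/-- Inner functions on `𝔻ⁿ`: members of `H^∞(𝔻ⁿ)`, that is, bounded holomorphic functions, whose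
radial limit `lim_{r → 1⁻} φ(rw)` has modulus one for almost every `w ∈ 𝕋ⁿ`. -/
structure IsInner {n : ℕ} (φ : polydisc n → ℂ) : Prop where
  holomorphic : IsHolomorphic φ
  bounded : ∃ C : ℝ, ∀ z, ‖φ z‖ ≤ C
  radial_limit : ∀ᵐ θ ∂torusMeasure n, ∃ l : ℂ, ‖l‖ = 1 ∧
    Tendsto (fun r : ℝ => zeroExt φ (torusPoint (fun _ => r) θ)) (𝓝[<] 1) (𝓝 l)

/-- The linear space `φ H²(𝔻ⁿ) = {φ g : g ∈ H²(𝔻ⁿ)}` of functions on `𝔻ⁿ`. -/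
noncomputable def mulH2 {n : ℕ} (φ : polydisc n → ℂ) : Submodule ℂ (polydisc n → ℂ) :=
  (H2 n).map (LinearMap.mulLeft ℂ φ)

end HardyPolydisc

open HardyPolydisc

/-!
Everything is moved to the torus `𝕋ⁿ`, where the Hardy space becomes the space of square integrable
functions whose Fourier coefficients vanish outside `ℕⁿ` (`HasBoundary`,
`exists_hasBoundary_of_mem_H2`, `exists_mem_H2_hasBoundary`), where products go to products
(`HasBoundary.mul`), and where inner functions become unimodular (`IsInner.exists_hasBoundary`).

Let `φ a = ψ b` with `a`, `b` in the Hardy space. On the torus `k = conj ψ * a` satisfies `ψ k = a`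
and is square integrable; the point is that its Fourier coefficients vanish outside `ℕⁿ`, for then
`k` is in the Hardy space and `φ a = φ ψ k`. The space of polynomials in a single coordinate `zᵢ`
is infinite-dimensional, so by finite codimension some nonzero `p (zᵢ)` is of the form `φ u + ψ v`
(`exists_eval_coord_mem`). Then `p (zᵢ) k = b u + a v` on the torus, and this product has no
coefficients outside `ℕⁿ` (`mFourierCoeff_eval_mul_quotient_eq_zero`). Now take a frequency with a
negative coordinate `l`, and, as `n > 1`, some `i ≠ l`. The line through it in direction `i` lies
entirely outside `ℕⁿ`, so along this line the coefficients of `k` satisfy the linear recurrence given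
by `p`. They also tend to zero in both directions, so they vanish
(`mFourierCoeff_eq_zero_of_polynomial_mul`).
-/

open UnitAddTorus
open scoped ComplexConjugate

namespace HardyPolydisc

/-! ### Fourier coefficients on the torus -/

instance {n : ℕ} : IsProbabilityMeasure (torusMeasure n) := by
  unfold torusMeasure; infer_instance

instance {n : ℕ} : (torusMeasure n).IsAddLeftInvariant := by
  unfold torusMeasure; infer_instance

instance {n : ℕ} : (torusMeasure n).IsOpenPosMeasure := by
  unfold torusMeasure; infer_instance

/-- Mathlib's Fourier coefficients use the normalized measure on each circle, so they are integrals
against `torusMeasure`. -/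
theorem mFourierCoeff_def {n : ℕ} (F : UnitAddTorus (Fin n) → ℂ) (k : Fin n → ℤ) :
    mFourierCoeff F k = ∫ θ, mFourier (-k) θ * F θ ∂torusMeasure n := rfl

theorem mFourierCoeff_congr_ae {n : ℕ} {F G : UnitAddTorus (Fin n) → ℂ}
    (h : F =ᵐ[torusMeasure n] G) (k : Fin n → ℤ) : mFourierCoeff F k = mFourierCoeff G k := by
  simp only [mFourierCoeff_def]
  refine integral_congr_ae ?_
  filter_upwards [h] with θ hθ
  rw [hθ]

/-- The trigonometric monomials as a Hilbert basis of `L²(𝕋ⁿ)`, with the measure spelled out as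
`torusMeasure n`. -/
noncomputable def torusBasis (n : ℕ) : HilbertBasis (Fin n → ℤ) ℂ (Lp ℂ 2 (torusMeasure n)) :=
  mFourierBasis

theorem torusBasis_repr {n : ℕ} (f : Lp ℂ 2 (torusMeasure n)) (k : Fin n → ℤ) :
    (torusBasis n).repr f k = mFourierCoeff f k :=
  mFourierBasis_repr f k

theorem norm_mFourier_apply {n : ℕ} (k : Fin n → ℤ) (θ : UnitAddTorus (Fin n)) :
    ‖mFourier k θ‖ = 1 := by
  rw [mFourier, ContinuousMap.coe_mk, norm_prod]
  exact Finset.prod_eq_one fun i _ => by rw [fourier_apply, Circle.norm_coe]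

theorem integrable_mFourier_mul {n : ℕ} {F : UnitAddTorus (Fin n) → ℂ} (k : Fin n → ℤ)
    (hF : Integrable F (torusMeasure n)) :
    Integrable (fun θ => mFourier k θ * F θ) (torusMeasure n) :=
  hF.bdd_mul (c := 1) (mFourier k).continuous.aestronglyMeasurable
    (Eventually.of_forall fun θ => (norm_mFourier_apply k θ).le)

theorem ae_eq_of_mFourierCoeff_eq {n : ℕ} {F G : UnitAddTorus (Fin n) → ℂ}
    (hF : MemLp F 2 (torusMeasure n)) (hG : MemLp G 2 (torusMeasure n))
    (h : ∀ k, mFourierCoeff F k = mFourierCoeff G k) : F =ᵐ[torusMeasure n] G := by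
  have : hF.toLp F = hG.toLp G := by
    refine (torusBasis n).repr.injective ?_
    ext k
    rw [torusBasis_repr, torusBasis_repr, mFourierCoeff_congr_ae hF.coeFn_toLp,
      mFourierCoeff_congr_ae hG.coeFn_toLp, h]
  exact (MemLp.toLp_eq_toLp_iff hF hG).1 this

theorem hasSum_sq_norm_mFourierCoeff {n : ℕ} {F : UnitAddTorus (Fin n) → ℂ}
    (hF : MemLp F 2 (torusMeasure n)) :
    HasSum (fun k => ‖mFourierCoeff F k‖ ^ 2) (∫ θ, ‖F θ‖ ^ 2 ∂torusMeasure n) := by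
  have h : HasSum (fun k => ‖mFourierCoeff (hF.toLp F) k‖ ^ 2)
      (∫ θ, ‖hF.toLp F θ‖ ^ 2 ∂torusMeasure n) := hasSum_sq_mFourierCoeff _
  simp only [mFourierCoeff_congr_ae hF.coeFn_toLp] at h
  convert h using 1
  refine integral_congr_ae ?_
  filter_upwards [hF.coeFn_toLp] with θ hθ
  rw [hθ]

theorem mFourierCoeff_mFourier_mul {n : ℕ} (F : UnitAddTorus (Fin n) → ℂ) (m k : Fin n → ℤ) :
    mFourierCoeff (fun θ => mFourier m θ * F θ) k = mFourierCoeff F (k - m) := by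
  simp only [mFourierCoeff_def]
  congr 1 with θ
  rw [← mul_assoc, ← mFourier_add, neg_sub, neg_add_eq_sub]

/-- The Fourier coefficients of a product of two square integrable functions are the convolution of
the coefficients of the factors; this is Parseval's identity for `conj F` and `G`. -/
theorem mFourierCoeff_mul {n : ℕ} {F G : UnitAddTorus (Fin n) → ℂ}
    (hF : MemLp F 2 (torusMeasure n)) (hG : MemLp G 2 (torusMeasure n)) (k : Fin n → ℤ) :
    mFourierCoeff (fun θ => F θ * G θ) k =
      ∑' j, mFourierCoeff F j * mFourierCoeff G (k - j) := by
  have hF' : MemLp (fun θ => conj (F θ)) 2 (torusMeasure n) := hF.star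
  have hG' : MemLp (fun θ => mFourier (-k) θ * G θ) 2 (torusMeasure n) :=
    hG.mul (p := ∞) (memLp_top_of_bound (mFourier (-k)).continuous.aestronglyMeasurable 1
      (Eventually.of_forall fun θ => (norm_mFourier_apply _ θ).le))
  have h : HasSum (fun j => conj (mFourierCoeff (hF'.toLp _) j) * mFourierCoeff (hG'.toLp _) j)
      (∫ θ, conj (hF'.toLp _ θ) * hG'.toLp _ θ ∂torusMeasure n) := hasSum_prod_mFourierCoeff _ _
  simp only [mFourierCoeff_congr_ae hF'.coeFn_toLp, mFourierCoeff_congr_ae hG'.coeFn_toLp,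
    mFourierCoeff_mFourier_mul] at h
  have hint : (∫ θ, conj (hF'.toLp _ θ) * hG'.toLp _ θ ∂torusMeasure n) =
      mFourierCoeff (fun θ => F θ * G θ) k := by
    rw [mFourierCoeff_def]
    refine integral_congr_ae ?_
    filter_upwards [hF'.coeFn_toLp, hG'.coeFn_toLp] with θ h1 h2
    rw [h1, h2, Complex.conj_conj]
    ring
  have hconj : ∀ j, conj (mFourierCoeff (fun θ => conj (F θ)) j) = mFourierCoeff F (-j) := by
    intro j
    simp only [mFourierCoeff_def]
    rw [← integral_conj]
    congr 1 with θ
    rw [map_mul, Complex.conj_conj, mFourier_neg, mFourier_neg (n := -j), mFourier_neg]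
  rw [hint] at h
  rw [← h.tsum_eq, ← (Equiv.neg (Fin n → ℤ)).tsum_eq]
  refine tsum_congr fun j => ?_
  simp only [Equiv.neg_apply, hconj]
  rw [neg_neg, show -j - -k = k - j by abel]

/-- Riesz–Fischer on the torus. -/
theorem exists_memLp_mFourierCoeff_eq {n : ℕ} {c : (Fin n → ℤ) → ℂ}
    (hc : Summable fun k => ‖c k‖ ^ 2) :
    ∃ F : UnitAddTorus (Fin n) → ℂ, MemLp F 2 (torusMeasure n) ∧ ∀ k, mFourierCoeff F k = c k := by
  have hc' : Memℓp c 2 := (memℓp_gen_iff (by norm_num)).2 (by simpa using hc)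
  refine ⟨(torusBasis n).repr.symm ⟨c, hc'⟩, Lp.memLp _, fun k => ?_⟩
  rw [← torusBasis_repr, LinearIsometryEquiv.apply_symm_apply]

theorem mFourierCoeff_add {n : ℕ} {F G : UnitAddTorus (Fin n) → ℂ}
    (hF : Integrable F (torusMeasure n)) (hG : Integrable G (torusMeasure n)) (k : Fin n → ℤ) :
    mFourierCoeff (fun θ => F θ + G θ) k = mFourierCoeff F k + mFourierCoeff G k := by
  simp only [mFourierCoeff_def, mul_add]
  exact integral_add (integrable_mFourier_mul _ hF) (integrable_mFourier_mul _ hG)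

theorem mFourierCoeff_sum_smul_mFourier_mul {n : ℕ} {ι : Type*} (s : Finset ι) (a : ι → ℂ)
    (m : ι → Fin n → ℤ) {F : UnitAddTorus (Fin n) → ℂ} (hF : Integrable F (torusMeasure n))
    (k : Fin n → ℤ) :
    mFourierCoeff (fun θ => (∑ l ∈ s, a l * mFourier (m l) θ) * F θ) k =
      ∑ l ∈ s, a l * mFourierCoeff F (k - m l) := by
  have h : ∀ θ, mFourier (-k) θ * ((∑ l ∈ s, a l * mFourier (m l) θ) * F θ) =
      ∑ l ∈ s, a l * (mFourier (-k) θ * (mFourier (m l) θ * F θ)) := by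
    intro θ
    rw [Finset.sum_mul, Finset.mul_sum]
    exact Finset.sum_congr rfl fun l _ => by ring
  simp only [← mFourierCoeff_mFourier_mul F]
  simp only [mFourierCoeff_def, h]
  rw [integral_finsetSum _ fun l _ => (integrable_mFourier_mul _
    (integrable_mFourier_mul _ hF)).const_mul _]
  exact Finset.sum_congr rfl fun l _ => integral_const_mul _ _

theorem mFourierCoeff_mFourier {n : ℕ} (m k : Fin n → ℤ) :
    mFourierCoeff (fun θ => mFourier m θ) k = if m = k then 1 else 0 := by
  have h : (torusBasis n).repr (torusBasis n m) k = if m = k then 1 else 0 := by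
    rw [HilbertBasis.repr_apply_apply, orthonormal_iff_ite.1 (torusBasis n).orthonormal]
    simp [eq_comm]
  rw [← h, torusBasis_repr]
  refine mFourierCoeff_congr_ae ?_ k
  have : torusBasis n m = mFourierLp 2 m := congrFun coe_mFourierBasis m
  rw [this]
  exact (coeFn_mFourierLp 2 m).symm

/-! ### Power series coefficients of holomorphic functions on the polydisc -/

/-- The Fourier coefficients of a holomorphic function on circles `|z| = s` inside the unit disc are
its Taylor coefficients, scaled by powers of `s`. -/
theorem exists_fourierCoeff_circle_eq {g : ℂ → ℂ} (hg : DifferentiableOn ℂ g (Metric.ball 0 1)) :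
    ∃ a : ℕ → ℂ, ∀ s : ℝ, 0 ≤ s → s < 1 → ∀ m : ℤ,
      ∫ t : UnitAddCircle, fourier (-m) t * g (s * t.toCircle) ∂AddCircle.haarAddCircle =
        if 0 ≤ m then (s : ℂ) ^ m.toNat * a m.toNat else 0 := by
  refine ⟨fun l => (l.factorial : ℂ)⁻¹ * iteratedDeriv l g 0, fun s hs0 hs1 m => ?_⟩
  set a : ℕ → ℂ := fun l => (l.factorial : ℂ)⁻¹ * iteratedDeriv l g 0 with ha
  have hsum : ∀ z ∈ Metric.ball (0 : ℂ) 1, HasSum (fun l => a l * z ^ l) (g z) := by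
    intro z hz
    have h := Complex.hasSum_taylorSeries_on_ball hg hz
    refine h.congr_fun fun l => ?_
    simp only [ha, sub_zero, smul_eq_mul]
    ring
  clear_value a
  have hmem : ∀ t : UnitAddCircle, (s : ℂ) * t.toCircle ∈ Metric.ball (0 : ℂ) 1 := by
    intro t
    rw [mem_ball_zero_iff, norm_mul, Circle.norm_coe, mul_one, Complex.norm_real,
      Real.norm_of_nonneg hs0]
    exact hs1
  have hpow : ∀ (l : ℕ) (t : UnitAddCircle), (t.toCircle : ℂ) ^ l = fourier (l : ℤ) t := by
    intro l t
    rw [fourier_apply, AddCircle.toCircle_zsmul, Circle.coe_zpow, zpow_natCast]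
  have habs : Summable fun l => ‖a l * (s : ℂ) ^ l‖ := by
    have := (hsum s (by simpa [abs_of_nonneg hs0] using hs1)).summable
    exact this.norm
  have hterm : ∀ l : ℕ, Integrable
      (fun t : UnitAddCircle => fourier (-m) t * (a l * (s * (t.toCircle : ℂ)) ^ l))
      AddCircle.haarAddCircle := by
    intro l
    refine Continuous.integrable_of_hasCompactSupport ?_ (HasCompactSupport.of_compactSpace _)
    have : Continuous fun t : UnitAddCircle => (t.toCircle : ℂ) :=
      continuous_subtype_val.comp AddCircle.continuous_toCircle
    fun_prop
  have hnorm : ∀ (l : ℕ) (t : UnitAddCircle),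
      ‖fourier (-m) t * (a l * (s * (t.toCircle : ℂ)) ^ l)‖ = ‖a l * (s : ℂ) ^ l‖ := by
    intro l t
    rw [fourier_apply, norm_mul, Circle.norm_coe, one_mul, norm_mul, norm_pow, norm_mul,
      Circle.norm_coe, mul_one, norm_mul, norm_pow]
  have hint := hasSum_integral_of_summable_integral_norm hterm (by
    simp only [hnorm]
    simpa using habs)
  have htsum : ∀ t : UnitAddCircle, ∑' l, fourier (-m) t * (a l * (s * (t.toCircle : ℂ)) ^ l) =
      fourier (-m) t * g (s * t.toCircle) := fun t =>
    ((hsum _ (hmem t)).mul_left _).tsum_eq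
  simp only [htsum] at hint
  have hcoef : ∀ l : ℕ, ∫ t : UnitAddCircle, fourier (-m) t * (a l * (s * (t.toCircle : ℂ)) ^ l)
      ∂AddCircle.haarAddCircle = a l * (s : ℂ) ^ l * if (l : ℤ) = m then 1 else 0 := by
    intro l
    have h1 : ∫ t : UnitAddCircle, fourier (-m) t * fourier (l : ℤ) t ∂AddCircle.haarAddCircle =
        if (l : ℤ) = m then 1 else 0 := by
      have h2 := congrFun (fourierCoeff_fourier (T := 1) (l : ℤ)) m
      rw [Pi.single_apply] at h2
      simpa only [eq_comm] using! h2
    rw [← h1, ← integral_const_mul]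
    congr 1 with t
    rw [mul_pow, hpow]
    ring
  simp only [hcoef] at hint
  split_ifs with hm
  · rw [← hint.tsum_eq, tsum_eq_single m.toNat fun l hl => ?_]
    · rw [if_pos (Int.toNat_of_nonneg hm), mul_one, mul_comm]
    · rw [if_neg (by omega), mul_zero]
  · rw [← hint.tsum_eq]
    refine (tsum_congr fun l => ?_).trans tsum_zero
    rw [if_neg (by omega), mul_zero]

theorem mFourier_add_single {n : ℕ} (k : Fin n → ℤ) (θ : UnitAddTorus (Fin n)) (i : Fin n)
    (t : UnitAddCircle) :
    mFourier k (θ + Pi.single i t) = mFourier k θ * fourier (k i) t := by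
  have h : ∀ j, fourier (k j) ((θ + Pi.single i t : UnitAddTorus (Fin n)) j) =
      fourier (k j) (θ j) * if j = i then fourier (k i) t else 1 := by
    intro j
    by_cases hj : j = i
    · subst hj
      simp [fourier_apply, AddCircle.toCircle_add]
    · simp [hj]
  simp only [mFourier, ContinuousMap.coe_mk, h, Finset.prod_mul_distrib, Finset.prod_ite_eq',
    Finset.mem_univ, if_true]

theorem torusPoint_update_add_single {n : ℕ} (r : Fin n → ℝ) (θ : UnitAddTorus (Fin n)) (i : Fin n)
    (s : ℝ) (t : UnitAddCircle) :
    torusPoint (Function.update r i s) (θ + Pi.single i t) =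
      Function.update (torusPoint r θ) i ((s : ℂ) * t.toCircle * (θ i).toCircle) := by
  ext j
  by_cases hj : j = i
  · subst hj
    simp [torusPoint, AddCircle.toCircle_add]
    ring
  · simp [torusPoint, hj]

/-- An average over the torus may be computed by first averaging over rotations of a single
coordinate. -/
theorem integral_torus_eq_integral_rotate {n : ℕ} {G : UnitAddTorus (Fin n) → ℂ} (hG : Continuous G)
    (i : Fin n) :
    ∫ θ, G θ ∂torusMeasure n =
      ∫ θ, ∫ t : UnitAddCircle, G (θ + Pi.single i t) ∂AddCircle.haarAddCircle ∂torusMeasure n := by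
  rw [integral_integral_swap]
  · have : ∀ t : UnitAddCircle, ∫ θ, G (θ + Pi.single i t) ∂torusMeasure n =
        ∫ θ, G θ ∂torusMeasure n := fun t => integral_add_right_eq_self G _
    simp [this]
  · refine Continuous.integrable_of_hasCompactSupport ?_ (HasCompactSupport.of_compactSpace _)
    exact hG.comp (continuous_fst.add ((continuous_single i).comp continuous_snd))

/-- The Fourier coefficients of a holomorphic function over a torus, as a function of the `i`-th
radius. -/
theorem exists_mFourierCoeff_update_eq {n : ℕ} {f : polydisc n → ℂ} (hf : IsHolomorphic f)
    {r : Fin n → ℝ} (hr : ∀ i, 0 ≤ r i ∧ r i < 1) (i : Fin n) (k : Fin n → ℤ) :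
    ∃ A : ℂ, ∀ s : ℝ, 0 ≤ s → s < 1 →
      mFourierCoeff (fun θ => zeroExt f (torusPoint (Function.update r i s) θ)) k =
        if 0 ≤ k i then (s : ℂ) ^ (k i).toNat * A else 0 := by
  have hdiff : ∀ θ : UnitAddTorus (Fin n), DifferentiableOn ℂ
      (fun w : ℂ => zeroExt f (Function.update (torusPoint r θ) i (w * (θ i).toCircle)))
      (Metric.ball 0 1) := by
    intro θ
    refine DifferentiableOn.comp (t := polydisc n) hf ?_ ?_
    · have h1 : Differentiable ℂ fun w : ℂ =>
          Function.update (torusPoint r θ) i (w * (θ i).toCircle) := by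
        rw [differentiable_pi]
        intro j
        by_cases hj : j = i
        · subst hj
          simp only [Function.update_self]
          fun_prop
        · simp only [Function.update_of_ne hj]
          fun_prop
      exact h1.differentiableOn
    · intro w hw j
      by_cases hj : j = i
      · subst hj
        simp only [Function.update_self]
        rw [norm_mul, Circle.norm_coe, mul_one]
        simpa using hw
      · simp only [Function.update_of_ne hj]
        exact torusPoint_mem hr θ j
  choose a ha using fun θ => exists_fourierCoeff_circle_eq (hdiff θ)
  refine ⟨∫ θ, mFourier (-k) θ * a θ (k i).toNat ∂torusMeasure n, fun s hs0 hs1 => ?_⟩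
  have hr' : ∀ j, 0 ≤ Function.update r i s j ∧ Function.update r i s j < 1 := by
    intro j
    by_cases hj : j = i
    · subst hj
      simpa using ⟨hs0, hs1⟩
    · simpa [hj] using hr j
  have hcont : Continuous fun θ => mFourier (-k) θ *
      zeroExt f (torusPoint (Function.update r i s) θ) :=
    (mFourier (-k)).continuous.mul (hf.continuous_torus hr')
  rw [mFourierCoeff_def, integral_torus_eq_integral_rotate hcont i]
  have h : ∀ θ : UnitAddTorus (Fin n), ∫ t : UnitAddCircle, mFourier (-k) (θ + Pi.single i t) *
      zeroExt f (torusPoint (Function.update r i s) (θ + Pi.single i t)) ∂AddCircle.haarAddCircle =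
      mFourier (-k) θ * if 0 ≤ k i then (s : ℂ) ^ (k i).toNat * a θ (k i).toNat else 0 := by
    intro θ
    rw [← ha θ s hs0 hs1, ← integral_const_mul]
    congr 1 with t
    rw [mFourier_add_single, torusPoint_update_add_single, Pi.neg_apply]
    ring
  simp only [h]
  split_ifs
  · rw [← integral_const_mul]
    congr 1 with θ
    ring
  · simp

/-- The modulus `∏ᵢ rᵢ ^ kᵢ` of the monomial `z ^ k` on the torus of radii `r`; meant for
exponents `k ≥ 0`. -/
noncomputable def radialPow {n : ℕ} (r : Fin n → ℝ) (k : Fin n → ℤ) : ℝ :=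
  ∏ i, r i ^ (k i).toNat

/-- A holomorphic function on the polydisc has power series coefficients: its Fourier coefficients
over the torus of radii `r` are those coefficients scaled by `r ^ k`, and vanish unless `k ≥ 0`. -/
theorem IsHolomorphic.exists_mFourierCoeff_eq {n : ℕ} {f : polydisc n → ℂ} (hf : IsHolomorphic f) :
    ∃ c : (Fin n → ℤ) → ℂ, (∀ k, ¬ 0 ≤ k → c k = 0) ∧
      ∀ r : Fin n → ℝ, (∀ i, 0 ≤ r i ∧ r i < 1) → ∀ k,
        mFourierCoeff (fun θ => zeroExt f (torusPoint r θ)) k = radialPow r k * c k := by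
  classical
  set N : (Fin n → ℝ) → (Fin n → ℤ) → ℂ :=
    fun r k => mFourierCoeff (fun θ => zeroExt f (torusPoint r θ)) k with hN
  let h₀ : Fin n → ℝ := fun _ => 1 / 2
  refine ⟨fun k => if 0 ≤ k then (∏ i, 2 ^ (k i).toNat) * N h₀ k else 0,
    fun k hk => if_neg hk, fun r hr k => ?_⟩
  change N r k = (radialPow r k : ℂ) * if 0 ≤ k then (∏ i, 2 ^ (k i).toNat) * N h₀ k else 0
  by_cases hk : 0 ≤ k
  -- The radii are changed from `1 / 2` to `r i` one coordinate at a time.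
  · have key : ∀ S : Finset (Fin n), N (S.piecewise r h₀) k =
        (∏ i ∈ S, ((r i : ℂ) * 2) ^ (k i).toNat) * N h₀ k := by
      intro S
      induction S using Finset.induction_on with
      | empty => simp
      | insert i S hi ih =>
        have hq : ∀ j, 0 ≤ S.piecewise r h₀ j ∧ S.piecewise r h₀ j < 1 := by
          intro j
          by_cases hj : j ∈ S
          · simpa [hj] using hr j
          · simp only [hj, not_false_eq_true, Finset.piecewise_eq_of_notMem, h₀]
            norm_num
        obtain ⟨A, hA⟩ := exists_mFourierCoeff_update_eq hf hq i k
        have h1 := hA (r i) (hr i).1 (hr i).2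
        have h2 := hA (1 / 2) (by norm_num) (by norm_num)
        have h3 : Function.update (S.piecewise r h₀) i (1 / 2) = S.piecewise r h₀ := by
          rw [Function.update_eq_self_iff]
          simp [hi, h₀]
        have hki : 0 ≤ k i := hk i
        rw [h3, if_pos hki] at h2
        rw [if_pos hki] at h1
        rw [Finset.piecewise_insert, Finset.prod_insert hi, mul_assoc, ← ih]
        change mFourierCoeff _ k = _ * mFourierCoeff _ k
        rw [h1, h2, mul_pow, mul_assoc, ← mul_assoc (2 ^ _), ← mul_pow]
        norm_num
    have := key Finset.univ
    rw [Finset.piecewise_univ] at this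
    rw [this, if_pos hk, radialPow]
    push_cast
    simp only [mul_pow, Finset.prod_mul_distrib]
    ring
  · rw [if_neg hk, mul_zero]
    obtain ⟨i, hi⟩ : ∃ i, ¬ 0 ≤ k i := by simpa [Pi.le_def] using hk
    obtain ⟨A, hA⟩ := exists_mFourierCoeff_update_eq hf hr i k
    have := hA (r i) (hr i).1 (hr i).2
    rwa [if_neg hi, Function.update_eq_self] at this

/-! ### Boundary functions -/

theorem radialPow_nonneg {n : ℕ} {r : Fin n → ℝ} (hr : ∀ i, 0 ≤ r i) (k : Fin n → ℤ) :
    0 ≤ radialPow r k :=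
  Finset.prod_nonneg fun i _ => pow_nonneg (hr i) _

theorem radialPow_le_one {n : ℕ} {r : Fin n → ℝ} (hr : ∀ i, 0 ≤ r i ∧ r i < 1) (k : Fin n → ℤ) :
    radialPow r k ≤ 1 :=
  Finset.prod_le_one (fun i _ => pow_nonneg (hr i).1 _)
    fun i _ => pow_le_one₀ (hr i).1 (hr i).2.le

theorem radialPow_add {n : ℕ} (r : Fin n → ℝ) {j k : Fin n → ℤ} (hj : 0 ≤ j) (hk : 0 ≤ k) :
    radialPow r (j + k) = radialPow r j * radialPow r k := by
  rw [radialPow, radialPow, radialPow, ← Finset.prod_mul_distrib]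
  refine Finset.prod_congr rfl fun i _ => ?_
  rw [Pi.add_apply, Int.toNat_add (hj i) (hk i), pow_add]

theorem tendsto_radialPow {n : ℕ} (k : Fin n → ℤ) :
    Tendsto (fun t : ℝ => radialPow (fun _ : Fin n => t) k) (𝓝[<] 1) (𝓝 1) := by
  have h : Continuous fun t : ℝ => radialPow (fun _ : Fin n => t) k :=
    continuous_finsetProd _ fun i _ => continuous_id.pow _
  have h1 := h.tendsto 1
  simp only [radialPow, one_pow, Finset.prod_const_one] at h1
  exact h1.mono_left nhdsWithin_le_nhds

theorem eventually_mem_Ico_nhdsWithin_one : ∀ᶠ t : ℝ in 𝓝[<] 1, 0 ≤ t ∧ t < 1 := by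
  filter_upwards [Ico_mem_nhdsLT (show (0 : ℝ) < 1 by norm_num)] with t ht using ht

/-- `F` is a boundary function of `f` on the torus `𝕋ⁿ`, in terms of Fourier coefficients: the
coefficients of `F` vanish outside `ℕⁿ`, and those of `f` over the torus of radii `r` are the
coefficients of `F` scaled by `r ^ k`, so that `f` is the power series with the coefficients
of `F`. -/
structure HasBoundary {n : ℕ} (f : polydisc n → ℂ) (F : UnitAddTorus (Fin n) → ℂ) : Prop where
  coeff_eq_zero : ∀ k, ¬ 0 ≤ k → mFourierCoeff F k = 0
  coeff_eq : ∀ r : Fin n → ℝ, (∀ i, 0 ≤ r i ∧ r i < 1) → ∀ k,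
    mFourierCoeff (fun θ => zeroExt f (torusPoint r θ)) k = radialPow r k * mFourierCoeff F k

theorem _root_.Continuous.memLp_torus {n : ℕ} {G : UnitAddTorus (Fin n) → ℂ} (hG : Continuous G)
    (p : ℝ≥0∞) : MemLp G p (torusMeasure n) :=
  hG.memLp_of_hasCompactSupport (HasCompactSupport.of_compactSpace _)

theorem HasBoundary.mFourierCoeff_unique {n : ℕ} {f : polydisc n → ℂ}
    {F G : UnitAddTorus (Fin n) → ℂ} (hF : HasBoundary f F) (hG : HasBoundary f G)
    (k : Fin n → ℤ) : mFourierCoeff F k = mFourierCoeff G k := by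
  have hr : ∀ _ : Fin n, (0 : ℝ) ≤ 1 / 2 ∧ (1 / 2 : ℝ) < 1 := fun _ => by norm_num
  have h := (hF.coeff_eq _ hr k).symm.trans (hG.coeff_eq _ hr k)
  have h0 : (radialPow (fun _ : Fin n => (1 / 2 : ℝ)) k : ℂ) ≠ 0 :=
    Complex.ofReal_ne_zero.2 (Finset.prod_pos fun i _ => by positivity).ne'
  exact mul_left_cancel₀ h0 h

theorem exists_torusPoint_eq {n : ℕ} (z : Fin n → ℂ) :
    ∃ θ : UnitAddTorus (Fin n), torusPoint (fun i => ‖z i‖) θ = z := by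
  have h : ∀ w : ℂ, ∃ t : UnitAddCircle, (‖w‖ : ℂ) * t.toCircle = w := by
    intro w
    by_cases hw : w = 0
    · exact ⟨0, by simp [hw]⟩
    have hmem : w / ‖w‖ ∈ Submonoid.unitSphere ℂ := by
      simp [Submonoid.unitSphere, hw]
    obtain ⟨u, hu⟩ : ∃ u : Circle, (u : ℂ) = w / ‖w‖ := ⟨⟨_, hmem⟩, rfl⟩
    obtain ⟨t, ht⟩ := (AddCircle.homeomorphCircle (T := 1) one_ne_zero).surjective u
    rw [AddCircle.homeomorphCircle_apply] at ht
    refine ⟨t, ?_⟩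
    rw [ht, hu]
    exact mul_div_cancel₀ _ (by simpa using hw)
  choose θ hθ using fun i => h (z i)
  exact ⟨θ, funext hθ⟩

/-- A holomorphic function on the polydisc is determined by the Fourier coefficients of its boundary
function. -/
theorem HasBoundary.eq_of_coeff_eq {n : ℕ} {f g : polydisc n → ℂ} {F G : UnitAddTorus (Fin n) → ℂ}
    (hf : IsHolomorphic f) (hg : IsHolomorphic g) (hF : HasBoundary f F) (hG : HasBoundary g G)
    (h : ∀ k, mFourierCoeff F k = mFourierCoeff G k) : f = g := by
  ext z
  obtain ⟨θ, hθ⟩ := exists_torusPoint_eq z.1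
  have hr : ∀ i, 0 ≤ ‖z.1 i‖ ∧ ‖z.1 i‖ < 1 := fun i => ⟨norm_nonneg _, z.2 i⟩
  have hfc := hf.continuous_torus hr
  have hgc := hg.continuous_torus hr
  have hae := ae_eq_of_mFourierCoeff_eq (hfc.memLp_torus 2) (hgc.memLp_torus 2) fun k => by
    rw [hF.coeff_eq _ hr, hG.coeff_eq _ hr, h]
  have := congrFun ((hfc.ae_eq_iff_eq _ hgc).1 hae) θ
  simpa only [hθ, zeroExt_apply] using this

theorem IsHolomorphic.mul {n : ℕ} {f g : polydisc n → ℂ} (hf : IsHolomorphic f)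
    (hg : IsHolomorphic g) : IsHolomorphic (f * g) :=
  (DifferentiableOn.mul hf hg).congr fun z hz => by simp [zeroExt_apply_of_mem _ hz]

/-- Passing to boundary functions is multiplicative, since on both sides the Fourier coefficients
are convolved. -/
theorem HasBoundary.mul {n : ℕ} {f g : polydisc n → ℂ} {F G : UnitAddTorus (Fin n) → ℂ}
    (hf : IsHolomorphic f) (hg : IsHolomorphic g) (hF : HasBoundary f F) (hG : HasBoundary g G)
    (hF2 : MemLp F 2 (torusMeasure n)) (hG2 : MemLp G 2 (torusMeasure n)) :
    HasBoundary (f * g) fun θ => F θ * G θ := by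
  constructor
  · intro k hk
    rw [mFourierCoeff_mul hF2 hG2]
    refine (tsum_congr fun j => ?_).trans tsum_zero
    by_cases hj : 0 ≤ j
    · rw [hG.coeff_eq_zero (k - j) fun h => hk (by simpa using add_nonneg h hj), mul_zero]
    · rw [hF.coeff_eq_zero j hj, zero_mul]
  · intro r hr k
    have h : ∀ θ, zeroExt (f * g) (torusPoint r θ) =
        zeroExt f (torusPoint r θ) * zeroExt g (torusPoint r θ) := fun θ => by
      simp [zeroExt_apply_of_mem _ (torusPoint_mem hr θ)]
    simp only [h]
    rw [mFourierCoeff_mul ((hf.continuous_torus hr).memLp_torus 2)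
      ((hg.continuous_torus hr).memLp_torus 2), mFourierCoeff_mul hF2 hG2, ← tsum_mul_left]
    refine tsum_congr fun j => ?_
    rw [hF.coeff_eq r hr, hG.coeff_eq r hr]
    by_cases hj : 0 ≤ j
    · by_cases hkj : 0 ≤ k - j
      · have := radialPow_add r hj hkj
        rw [add_sub_cancel] at this
        rw [this]
        push_cast
        ring
      · rw [hG.coeff_eq_zero _ hkj]
        ring
    · rw [hF.coeff_eq_zero _ hj]
      ring

theorem lintegral_enorm_sq_eq {n : ℕ} {G : UnitAddTorus (Fin n) → ℂ}
    (hG : MemLp G 2 (torusMeasure n)) :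
    ∫⁻ θ, ‖G θ‖ₑ ^ 2 ∂torusMeasure n = ENNReal.ofReal (∫ θ, ‖G θ‖ ^ 2 ∂torusMeasure n) := by
  rw [ofReal_integral_eq_lintegral_ofReal ((memLp_two_iff_integrable_sq_norm hG.1).1 hG)
    (Eventually.of_forall fun θ => by positivity)]
  refine lintegral_congr fun θ => ?_
  rw [ENNReal.ofReal_pow (norm_nonneg _), ofReal_norm]

/-- Parseval's identity on the torus of radius `t`, as `t → 1`, bounds the sum of the squared
coefficients, and Riesz–Fischer then gives the boundary function. -/
theorem exists_hasBoundary_of_mem_H2 {n : ℕ} {f : polydisc n → ℂ} (hf : f ∈ H2 n) :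
    ∃ F : UnitAddTorus (Fin n) → ℂ, MemLp F 2 (torusMeasure n) ∧ HasBoundary f F := by
  obtain ⟨hhol, hmean⟩ := hf
  obtain ⟨c, hc0, hc⟩ := hhol.exists_mFourierCoeff_eq
  have hsum : Summable fun k => ‖c k‖ ^ 2 := by
    refine summable_of_sum_le (c := (hardyMean f).toReal) (fun k => by positivity) fun s => ?_
    have hlim : Tendsto (fun t : ℝ => ∑ k ∈ s, ‖(radialPow (fun _ : Fin n => t) k : ℂ) * c k‖ ^ 2)
        (𝓝[<] 1) (𝓝 (∑ k ∈ s, ‖((1 : ℝ) : ℂ) * c k‖ ^ 2)) :=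
      tendsto_finsetSum _ fun k _ => ((((Complex.continuous_ofReal.tendsto 1).comp
        (tendsto_radialPow k)).mul_const _).norm.pow 2)
    simp only [Complex.ofReal_one, one_mul] at hlim
    refine le_of_tendsto hlim ?_
    filter_upwards [eventually_mem_Ico_nhdsWithin_one] with t ht
    have hr : ∀ _ : Fin n, 0 ≤ t ∧ t < 1 := fun _ => ht
    have hmem := (hhol.continuous_torus hr).memLp_torus 2
    have hP := hasSum_sq_norm_mFourierCoeff hmem
    simp only [hc _ hr] at hP
    refine (sum_le_hasSum s (fun _ _ => by positivity) hP).trans ?_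
    rw [← ENNReal.ofReal_le_iff_le_toReal hmean.ne, ← lintegral_enorm_sq_eq hmem]
    exact le_iSup₂_of_le (fun _ => t) hr le_rfl
  obtain ⟨F, hF2, hF⟩ := exists_memLp_mFourierCoeff_eq hsum
  exact ⟨F, hF2, fun k hk => by rw [hF, hc0 k hk], fun r hr k => by rw [hF, hc r hr]⟩

/-- For a bounded holomorphic function, the radial limit function is a boundary function. -/
theorem HasBoundary.of_radial_limit {n : ℕ} {f : polydisc n → ℂ} (hf : IsHolomorphic f) {C : ℝ}
    (hC : ∀ z, ‖f z‖ ≤ C) {F : UnitAddTorus (Fin n) → ℂ}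
    (hF : ∀ᵐ θ ∂torusMeasure n,
      Tendsto (fun r : ℝ => zeroExt f (torusPoint (fun _ => r) θ)) (𝓝[<] 1) (𝓝 (F θ))) :
    HasBoundary f F := by
  obtain ⟨c, hc0, hc⟩ := hf.exists_mFourierCoeff_eq
  have hcF : ∀ k, mFourierCoeff F k = c k := by
    intro k
    have h1 : Tendsto (fun t : ℝ => mFourierCoeff
        (fun θ => zeroExt f (torusPoint (fun _ => t) θ)) k) (𝓝[<] 1) (𝓝 (mFourierCoeff F k)) := by
      simp only [mFourierCoeff_def]
      refine tendsto_integral_filter_of_dominated_convergence (fun _ => C) ?_ ?_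
        (integrable_const _) ?_
      · filter_upwards [eventually_mem_Ico_nhdsWithin_one] with t ht
        exact ((mFourier (-k)).continuous.mul
          (hf.continuous_torus fun _ => ht)).aestronglyMeasurable
      · filter_upwards [eventually_mem_Ico_nhdsWithin_one] with t ht
        refine Eventually.of_forall fun θ => ?_
        rw [norm_mul, norm_mFourier_apply, one_mul,
          zeroExt_apply_of_mem _ (torusPoint_mem (fun _ => ht) θ)]
        exact hC _
      · filter_upwards [hF] with θ hθ
        exact hθ.const_mul _
    have h2 : Tendsto (fun t : ℝ => (radialPow (fun _ : Fin n => t) k : ℂ) * c k) (𝓝[<] 1)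
        (𝓝 (((1 : ℝ) : ℂ) * c k)) :=
      ((Complex.continuous_ofReal.tendsto 1).comp (tendsto_radialPow k)).mul_const _
    rw [Complex.ofReal_one, one_mul] at h2
    refine tendsto_nhds_unique (h1.congr' ?_) h2
    filter_upwards [eventually_mem_Ico_nhdsWithin_one] with t ht
    exact hc _ (fun _ => ht) k
  exact ⟨fun k hk => by rw [hcF, hc0 k hk], fun r hr k => by rw [hcF, hc r hr]⟩

theorem aestronglyMeasurable_of_radial_limit {n : ℕ} {f : polydisc n → ℂ} (hf : IsHolomorphic f)
    {F : UnitAddTorus (Fin n) → ℂ}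
    (hF : ∀ᵐ θ ∂torusMeasure n,
      Tendsto (fun r : ℝ => zeroExt f (torusPoint (fun _ => r) θ)) (𝓝[<] 1) (𝓝 (F θ))) :
    AEStronglyMeasurable F (torusMeasure n) := by
  obtain ⟨u, -, hu, hlim⟩ := exists_seq_strictMono_tendsto' (show (0 : ℝ) < 1 by norm_num)
  have hlim' : Tendsto u atTop (𝓝[<] 1) :=
    tendsto_nhdsWithin_iff.2 ⟨hlim, Eventually.of_forall fun m => (hu m).2⟩
  refine aestronglyMeasurable_of_tendsto_ae atTop
    (f := fun m θ => zeroExt f (torusPoint (fun _ => u m) θ)) (fun m => ?_) ?_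
  · exact (hf.continuous_torus fun _ => ⟨(hu m).1.le, (hu m).2⟩).aestronglyMeasurable
  · filter_upwards [hF] with θ hθ using hθ.comp hlim'

theorem IsInner.exists_hasBoundary {n : ℕ} {φ : polydisc n → ℂ} (hφ : IsInner φ) :
    ∃ F : UnitAddTorus (Fin n) → ℂ, MemLp F ∞ (torusMeasure n) ∧
      (∀ᵐ θ ∂torusMeasure n, ‖F θ‖ = 1) ∧ HasBoundary φ F := by
  classical
  obtain ⟨C, hC⟩ := hφ.bounded
  have h : ∀ θ, ∃ l : ℂ, (∃ l : ℂ, ‖l‖ = 1 ∧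
      Tendsto (fun r : ℝ => zeroExt φ (torusPoint (fun _ => r) θ)) (𝓝[<] 1) (𝓝 l)) →
      ‖l‖ = 1 ∧
      Tendsto (fun r : ℝ => zeroExt φ (torusPoint (fun _ => r) θ)) (𝓝[<] 1) (𝓝 l) := by
    intro θ
    by_cases hθ : ∃ l : ℂ, ‖l‖ = 1 ∧
        Tendsto (fun r : ℝ => zeroExt φ (torusPoint (fun _ => r) θ)) (𝓝[<] 1) (𝓝 l)
    · exact ⟨hθ.choose, fun _ => hθ.choose_spec⟩
    · exact ⟨0, fun h => absurd h hθ⟩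
  choose F hF using h
  have hnorm : ∀ᵐ θ ∂torusMeasure n, ‖F θ‖ = 1 := by
    filter_upwards [hφ.radial_limit] with θ hθ using (hF θ hθ).1
  have hlim : ∀ᵐ θ ∂torusMeasure n,
      Tendsto (fun r : ℝ => zeroExt φ (torusPoint (fun _ => r) θ)) (𝓝[<] 1) (𝓝 (F θ)) := by
    filter_upwards [hφ.radial_limit] with θ hθ using (hF θ hθ).2
  exact ⟨F, memLp_top_of_bound (aestronglyMeasurable_of_radial_limit hφ.holomorphic hlim) 1
    (hnorm.mono fun θ hθ => hθ.le), hnorm, HasBoundary.of_radial_limit hφ.holomorphic hC hlim⟩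

/-! ### Hardy functions with prescribed boundary function -/

/-- A product of nonnegative summable families, one for each coordinate, is summable over all
multi-indices. -/
theorem summable_prod_multiIndex {n : ℕ} {u : Fin n → ℕ → ℝ} (h0 : ∀ i l, 0 ≤ u i l)
    (hu : ∀ i, Summable (u i)) : Summable fun k : Fin n → ℕ => ∏ i, u i (k i) := by
  classical
  refine summable_of_sum_le (c := ∏ i, ∑' l, u i l)
    (fun k => Finset.prod_nonneg fun i _ => h0 i _) fun s => ?_
  calc ∑ k ∈ s, ∏ i, u i (k i)
      ≤ ∑ k ∈ Fintype.piFinset fun i => s.image fun k => k i, ∏ i, u i (k i) := by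
        refine Finset.sum_le_sum_of_subset_of_nonneg (fun k hk => ?_)
          fun k _ _ => Finset.prod_nonneg fun i _ => h0 i _
        exact Fintype.mem_piFinset.2 fun i => Finset.mem_image_of_mem _ hk
    _ = ∏ i, ∑ l ∈ s.image fun k => k i, u i l := (Finset.prod_univ_sum _ _).symm
    _ ≤ ∏ i, ∑' l, u i l := Finset.prod_le_prod (fun i _ => Finset.sum_nonneg fun l _ => h0 i l)
        fun i _ => (hu i).sum_le_tsum _ fun l _ => h0 i l

theorem summable_prod_pow {n : ℕ} {r : Fin n → ℝ} (hr : ∀ i, 0 ≤ r i ∧ r i < 1) :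
    Summable fun k : Fin n → ℕ => ∏ i, r i ^ k i :=
  summable_prod_multiIndex (u := fun i l => r i ^ l) (fun i l => pow_nonneg (hr i).1 l)
    fun i => summable_geometric_of_lt_one (hr i).1 (hr i).2

theorem hasFDerivAt_monomial {n : ℕ} (k : Fin n → ℕ) (z : Fin n → ℂ) :
    HasFDerivAt (fun z : Fin n → ℂ => ∏ i, z i ^ k i)
      (∑ i, (∏ j ∈ Finset.univ.erase i, z j ^ k j) •
        ((k i * z i ^ (k i - 1)) • ContinuousLinearMap.proj (R := ℂ) (φ := fun _ => ℂ) i)) z := by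
  refine HasFDerivAt.finsetProd (g := fun i (z : Fin n → ℂ) => z i ^ k i) fun i _ => ?_
  have h := (hasFDerivAt_apply (𝕜 := ℂ) i z).pow (k i)
  convert h using 1
  simp [nsmul_eq_mul, mul_smul]

/-- A power series with bounded coefficients is holomorphic in the polydisc. -/
theorem differentiableOn_tsum_monomial {n : ℕ} {c : (Fin n → ℕ) → ℂ} {B : ℝ} (hc : ∀ k, ‖c k‖ ≤ B) :
    DifferentiableOn ℂ (fun z : Fin n → ℂ => ∑' k : Fin n → ℕ, c k * ∏ i, z i ^ k i)
      (polydisc n) := by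
  classical
  intro z hz
  have hB : 0 ≤ B := (norm_nonneg _).trans (hc 0)
  have hz1 : ‖z‖ < 1 := (pi_norm_lt_iff one_pos).2 hz
  obtain ⟨ρ, hρ, hρ1⟩ := exists_between hz1
  have hρ0 : 0 < ρ := (norm_nonneg z).trans_lt hρ
  -- The summand indexed by `i` dominates the contribution of the derivative in direction `i`.
  let u : Fin n → Fin n → ℕ → ℝ := fun i j l => if j = i then l * ρ ^ (l - 1) else ρ ^ l
  have hu0 : ∀ i j l, 0 ≤ u i j l := by
    intro i j l
    simp only [u]
    split_ifs <;> positivity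
  have husum : ∀ i j, Summable (u i j) := by
    intro i j
    by_cases hj : j = i
    · simp only [u, hj, if_true]
      have h1 := summable_pow_mul_geometric_of_norm_lt_one (R := ℝ) 1 (r := ρ)
        (by rwa [Real.norm_of_nonneg hρ0.le])
      refine (h1.mul_left ρ⁻¹).congr fun l => ?_
      rcases Nat.eq_zero_or_pos l with rfl | hl
      · simp
      · obtain ⟨m, rfl⟩ := Nat.exists_eq_succ_of_ne_zero hl.ne'
        simp only [Nat.succ_eq_add_one, Nat.add_sub_cancel, pow_succ ρ m]
        field_simp
    · simp only [u, hj, if_false]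
      exact summable_geometric_of_lt_one hρ0.le hρ1
  have hU : Summable fun k : Fin n → ℕ => B * ∑ i, ∏ j, u i j (k j) :=
    (summable_sum fun i _ => summable_prod_multiIndex (hu0 i) (husum i)).mul_left B
  have hder := hasFDerivAt_tsum_of_isPreconnected (𝕜 := ℂ) hU (Metric.isOpen_ball (x := 0) (ε := ρ))
    (convex_ball (0 : Fin n → ℂ) ρ).isPreconnected
    (f := fun k z => c k * ∏ i, z i ^ k i) (x := z) (x₀ := 0)
    (fun k w _ => (hasFDerivAt_monomial k w).const_mul (c k)) ?_ (by simpa using hρ0) ?_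
    (by simpa using hρ)
  · exact hder.differentiableAt.differentiableWithinAt
  · intro k w hw
    have hwρ : ∀ i, ‖w i‖ ≤ ρ := fun i => (norm_le_pi_norm w i).trans
      (mem_ball_zero_iff.1 hw).le
    rw [norm_smul]
    refine mul_le_mul (hc k) ((norm_sum_le _ _).trans (Finset.sum_le_sum fun i _ => ?_))
      (norm_nonneg _) hB
    rw [norm_smul, norm_smul, norm_mul, norm_prod, norm_pow, Complex.norm_natCast,
      ← Finset.prod_erase_mul _ _ (Finset.mem_univ i)]
    have hproj : ‖ContinuousLinearMap.proj (R := ℂ) (φ := fun _ : Fin n => ℂ) i‖ ≤ 1 :=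
      ContinuousLinearMap.opNorm_le_bound _ zero_le_one fun v => by
        simpa using norm_le_pi_norm v i
    refine mul_le_mul ?_ ?_ (by positivity) (Finset.prod_nonneg fun j _ => hu0 i j _)
    · refine Finset.prod_le_prod (fun j _ => norm_nonneg _) fun j hj => ?_
      rw [norm_pow]
      simp only [u, (Finset.mem_erase.1 hj).1, if_false]
      exact pow_le_pow_left₀ (norm_nonneg _) (hwρ j) _
    · simp only [u, if_true]
      refine (mul_le_of_le_one_right (by positivity) hproj).trans ?_
      gcongr
      exact hwρ i
  · refine summable_of_ne_finset_zero (s := {0}) fun k hk => ?_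
    obtain ⟨i, hi⟩ := Function.ne_iff.1 (Finset.notMem_singleton.1 hk)
    rw [Finset.prod_eq_zero (Finset.mem_univ i), mul_zero]
    simpa using hi

/-- A multi-index in `ℕⁿ` as a frequency in `ℤⁿ`. -/
def natFreq {n : ℕ} (k : Fin n → ℕ) : Fin n → ℤ := fun i => k i

theorem prod_torusPoint_pow {n : ℕ} (r : Fin n → ℝ) (θ : UnitAddTorus (Fin n)) (k : Fin n → ℕ) :
    ∏ i, torusPoint r θ i ^ k i = (∏ i, (r i : ℂ) ^ k i) * mFourier (natFreq k) θ := by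
  rw [mFourier, ContinuousMap.coe_mk, ← Finset.prod_mul_distrib]
  refine Finset.prod_congr rfl fun i _ => ?_
  rw [torusPoint, mul_pow, fourier_apply, AddCircle.toCircle_zsmul, Circle.coe_zpow, natFreq,
    zpow_natCast]

/-- Integrating a uniformly convergent power series on a torus term by term. -/
theorem mFourierCoeff_tsum_monomial {n : ℕ} {c : (Fin n → ℕ) → ℂ} {B : ℝ} (hc : ∀ k, ‖c k‖ ≤ B)
    {r : Fin n → ℝ} (hr : ∀ i, 0 ≤ r i ∧ r i < 1) (m : Fin n → ℤ) :
    mFourierCoeff (fun θ => ∑' k : Fin n → ℕ, c k * ∏ i, torusPoint r θ i ^ k i) m =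
      ∑' k : Fin n → ℕ, c k * (∏ i, (r i : ℂ) ^ k i) * if natFreq k = m then 1 else 0 := by
  have hterm : ∀ (k : Fin n → ℕ) (θ : UnitAddTorus (Fin n)),
      mFourier (-m) θ * (c k * ∏ i, torusPoint r θ i ^ k i) =
        c k * (∏ i, (r i : ℂ) ^ k i) * (mFourier (-m) θ * mFourier (natFreq k) θ) := by
    intro k θ
    rw [prod_torusPoint_pow]
    ring
  have hint := hasSum_integral_of_summable_integral_norm (μ := torusMeasure n)
    (F := fun (k : Fin n → ℕ) θ => mFourier (-m) θ * (c k * ∏ i, torusPoint r θ i ^ k i))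
    (fun k => by
      simp only [hterm]
      exact memLp_one_iff_integrable.1 (Continuous.memLp_torus (by fun_prop) 1))
    (by
      simp only [hterm, norm_mul, norm_mFourier_apply, mul_one]
      simp only [integral_const, probReal_univ, one_smul]
      refine Summable.of_nonneg_of_le (fun k => by positivity) (fun k => ?_)
        ((summable_prod_pow hr).mul_left B)
      refine mul_le_mul (hc k) (le_of_eq ?_) (norm_nonneg _) ((norm_nonneg _).trans (hc k))
      rw [norm_prod]
      refine Finset.prod_congr rfl fun i _ => ?_
      rw [norm_pow, Complex.norm_real, Real.norm_of_nonneg (hr i).1])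
  simp only [tsum_mul_left] at hint
  rw [mFourierCoeff_def, ← hint.tsum_eq]
  refine tsum_congr fun k => ?_
  simp only [hterm]
  rw [integral_const_mul]
  exact congrArg _ (mFourierCoeff_mFourier (natFreq k) m)

theorem hardyMean_lt_top_of_hasBoundary {n : ℕ} {f : polydisc n → ℂ}
    {F : UnitAddTorus (Fin n) → ℂ} (hf : IsHolomorphic f) (hF2 : MemLp F 2 (torusMeasure n))
    (hF : HasBoundary f F) : hardyMean f < ∞ := by
  refine lt_of_le_of_lt (iSup₂_le fun r hr => ?_)
    (ENNReal.ofReal_lt_top (r := ∫ θ, ‖F θ‖ ^ 2 ∂torusMeasure n))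
  have hmem := (hf.continuous_torus hr).memLp_torus 2
  rw [lintegral_enorm_sq_eq hmem]
  refine ENNReal.ofReal_le_ofReal (hasSum_le (fun k => ?_) (hasSum_sq_norm_mFourierCoeff hmem)
    (hasSum_sq_norm_mFourierCoeff hF2))
  rw [hF.coeff_eq r hr, norm_mul, Complex.norm_real,
    Real.norm_of_nonneg (radialPow_nonneg (fun i => (hr i).1) k)]
  exact pow_le_pow_left₀ (mul_nonneg (radialPow_nonneg (fun i => (hr i).1) k) (norm_nonneg _))
    (mul_le_of_le_one_left (norm_nonneg _) (radialPow_le_one hr k)) 2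

/-- Every square integrable function on the torus whose Fourier coefficients vanish outside `ℕⁿ` is
the boundary function of a function in the Hardy space. -/
theorem exists_mem_H2_hasBoundary {n : ℕ} {F : UnitAddTorus (Fin n) → ℂ}
    (hF2 : MemLp F 2 (torusMeasure n)) (hF : ∀ k, ¬ 0 ≤ k → mFourierCoeff F k = 0) :
    ∃ f ∈ H2 n, HasBoundary f F := by
  -- `f` is the power series with the Fourier coefficients of `F`.
  let c : (Fin n → ℕ) → ℂ := fun k => mFourierCoeff F (natFreq k)
  obtain ⟨B, hB⟩ : ∃ B : ℝ, ∀ k, ‖c k‖ ≤ B := by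
    refine ⟨∫ θ, ‖F θ‖ ∂torusMeasure n, fun k => (norm_integral_le_integral_norm _).trans_eq ?_⟩
    refine integral_congr_ae (Eventually.of_forall fun θ => ?_)
    simp [norm_mFourier_apply]
  let f : polydisc n → ℂ := fun z => ∑' k : Fin n → ℕ, c k * ∏ i, z.1 i ^ k i
  have hf : IsHolomorphic f := (differentiableOn_tsum_monomial hB).congr fun z hz =>
    zeroExt_apply_of_mem f hz
  have hbd : HasBoundary f F := by
    refine ⟨hF, fun r hr m => ?_⟩
    have h1 : ∀ θ, zeroExt f (torusPoint r θ) =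
        ∑' k : Fin n → ℕ, c k * ∏ i, torusPoint r θ i ^ k i := fun θ =>
      zeroExt_apply_of_mem f (torusPoint_mem hr θ)
    simp only [h1]
    rw [mFourierCoeff_tsum_monomial hB hr]
    by_cases hm : 0 ≤ m
    · have hm' : natFreq (fun i => (m i).toNat) = m :=
        funext fun i => Int.toNat_of_nonneg (hm i)
      rw [tsum_eq_single fun i => (m i).toNat]
      · rw [if_pos hm', mul_one, mul_comm]
        simp only [c, hm', radialPow]
        push_cast
        rfl
      · intro k hk
        rw [if_neg, mul_zero]
        rintro rfl
        exact hk (funext fun i => by simp [natFreq])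
    · rw [hF m hm, mul_zero]
      refine (tsum_congr fun k => ?_).trans tsum_zero
      rw [if_neg, mul_zero]
      rintro rfl
      exact hm fun i => Int.natCast_nonneg _
  exact ⟨f, ⟨hf, hardyMean_lt_top_of_hasBoundary hf hF2 hbd⟩, hbd⟩

/-! ### Polynomial multipliers in one coordinate -/

/-- A two-sided geometric sequence is nondecreasing in modulus in one of the two directions. -/
theorem eq_zero_of_tendsto_of_geometric {c : ℤ → ℂ} (hc : Tendsto c cofinite (𝓝 0)) {a : ℂ}
    (h : ∀ j, c (j - 1) = a * c j) : c = 0 := by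
  ext j
  have hlim : ∀ e : ℕ → ℤ, Function.Injective e →
      Tendsto (fun m => ‖c (e m)‖) atTop (𝓝 0) := fun e he => by
    simpa [Nat.cofinite_eq_atTop] using (hc.comp he.tendsto_cofinite).norm
  rw [Pi.zero_apply, ← norm_le_zero_iff]
  rcases le_total ‖a‖ 1 with ha | ha
  -- `‖c j‖ ≤ ‖c (j + m)‖` for all `m` if `‖a‖ ≤ 1`, and `‖c j‖ ≤ ‖c (j - m)‖` if `1 ≤ ‖a‖`.
  · refine ge_of_tendsto (hlim (fun m => j + m) fun m m' hm => by simpa using hm)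
      (Eventually.of_forall fun m => ?_)
    induction m with
    | zero => simp
    | succ m ih =>
      refine ih.trans ?_
      have := h (j + (m + 1 : ℕ))
      rw [show j + ((m + 1 : ℕ) : ℤ) - 1 = j + m by push_cast; ring] at this
      rw [this, norm_mul]
      exact mul_le_of_le_one_left (norm_nonneg _) ha
  · refine ge_of_tendsto (hlim (fun m => j - m) fun m m' hm => by simpa using hm)
      (Eventually.of_forall fun m => ?_)
    induction m with
    | zero => simp
    | succ m ih =>
      refine ih.trans ?_
      have := h (j - m)
      rw [show j - (m : ℤ) - 1 = j - (m + 1 : ℕ) by push_cast; ring] at this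
      simp only [this, norm_mul]
      exact le_mul_of_one_le_left (norm_nonneg _) ha

/-- The bilateral shift on two-sided sequences. -/
def shift : Module.End ℂ (ℤ → ℂ) := LinearMap.funLeft ℂ ℂ fun j => j - 1

theorem shift_pow_apply (l : ℕ) (c : ℤ → ℂ) (j : ℤ) : (shift ^ l) c j = c (j - l) := by
  induction l generalizing j with
  | zero => simp
  | succ l ih =>
    rw [pow_succ', Module.End.mul_apply]
    change (shift ^ l) c (j - 1) = _
    rw [ih]
    congr 1
    push_cast
    ring

/-- A nonzero polynomial in the bilateral shift is injective on sequences tending to zero: it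
is a product of factors `shift - a`, and the kernel of such a factor consists of geometric
sequences. -/
theorem eq_zero_of_aeval_shift_eq_zero {p : Polynomial ℂ} (hp : p ≠ 0) {c : ℤ → ℂ}
    (hc : Tendsto c cofinite (𝓝 0)) (h : Polynomial.aeval shift p c = 0) : c = 0 := by
  -- Induction on the roots of `p`, generalizing `c`.
  have key : ∀ (s : Multiset ℂ) (c : ℤ → ℂ), Tendsto c cofinite (𝓝 0) →
      Polynomial.aeval shift (s.map fun a => Polynomial.X - Polynomial.C a).prod c = 0 →
      c = 0 := by
    intro s
    induction s using Multiset.induction_on with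
    | empty =>
      intro c _ h
      simpa using h
    | cons a s ih =>
      intro c hc h
      rw [Multiset.map_cons, Multiset.prod_cons, mul_comm, map_mul, Module.End.mul_apply] at h
      have hval : ∀ j, Polynomial.aeval shift (Polynomial.X - Polynomial.C a) c j =
          c (j - 1) - a * c j := by
        intro j
        simp only [map_sub, Polynomial.aeval_X, Polynomial.aeval_C]
        rfl
      have hlim : Tendsto (Polynomial.aeval shift (Polynomial.X - Polynomial.C a) c) cofinite
          (𝓝 0) := by
        have h1 : Tendsto (fun j : ℤ => c (j - 1)) cofinite (𝓝 0) :=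
          hc.comp (sub_left_injective (b := (1 : ℤ))).tendsto_cofinite
        have h2 := h1.sub (hc.const_mul a)
        rw [mul_zero, sub_zero] at h2
        exact h2.congr fun j => (hval j).symm
      have h0 := ih _ hlim h
      refine eq_zero_of_tendsto_of_geometric hc (a := a) fun j => ?_
      rw [← sub_eq_zero, ← hval, h0, Pi.zero_apply]
  have hsplit := (IsAlgClosed.splits p).eq_prod_roots
  rw [hsplit, map_mul, Polynomial.aeval_C, Module.End.mul_apply,
    Module.algebraMap_end_apply] at h
  exact key _ c hc ((smul_eq_zero.1 h).resolve_left (Polynomial.leadingCoeff_ne_zero.2 hp))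

/-- If `p ≠ 0` and multiplication by `p (e^{2πiθᵢ})` turns `F` into a function without frequencies
on a line in direction `i`, then `F` has no frequencies on that line either. -/
theorem mFourierCoeff_eq_zero_of_polynomial_mul {n : ℕ} {F : UnitAddTorus (Fin n) → ℂ}
    (hF : MemLp F 2 (torusMeasure n)) {p : Polynomial ℂ} (hp : p ≠ 0) (i : Fin n) (k : Fin n → ℤ)
    (h : ∀ m : ℤ, mFourierCoeff
      (fun θ => p.eval ((θ i).toCircle : ℂ) * F θ) (k + Pi.single i m) = 0) :
    mFourierCoeff F k = 0 := by
  have hlim : Tendsto (mFourierCoeff F) cofinite (𝓝 0) := by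
    have h1 := (hasSum_sq_norm_mFourierCoeff hF).summable.tendsto_cofinite_zero.sqrt
    simp only [Real.sqrt_sq (norm_nonneg _), Real.sqrt_zero] at h1
    exact tendsto_zero_iff_norm_tendsto_zero.2 h1
  have hinj : Function.Injective fun m : ℤ => k + Pi.single i m :=
    (add_right_injective k).comp (Pi.single_injective i)
  have hpoly : ∀ θ : UnitAddTorus (Fin n), p.eval ((θ i).toCircle : ℂ) =
      ∑ l ∈ Finset.range (p.natDegree + 1), p.coeff l * mFourier (Pi.single i (l : ℤ)) θ := by
    intro θ
    rw [Polynomial.eval_eq_sum_range]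
    refine Finset.sum_congr rfl fun l _ => ?_
    -- The monomial of frequency `l` in direction `i`, evaluated after splitting off coordinate `i`.
    have h1 := mFourier_add_single (Pi.single i (l : ℤ)) (Function.update θ i 0) i (θ i)
    have h2 : (Function.update θ i 0 + Pi.single i (θ i) : UnitAddTorus (Fin n)) = θ := by
      ext j
      by_cases hj : j = i
      · subst hj; simp
      · simp [hj]
    have h3 : mFourier (Pi.single i (l : ℤ)) (Function.update θ i 0) = 1 := by
      rw [mFourier, ContinuousMap.coe_mk]
      refine Finset.prod_eq_one fun j _ => ?_
      by_cases hj : j = i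
      · subst hj; simp
      · simp [hj]
    rw [h2, h3, one_mul, Pi.single_eq_same] at h1
    rw [h1, fourier_apply, AddCircle.toCircle_zsmul, Circle.coe_zpow, zpow_natCast]
  have h0 := eq_zero_of_aeval_shift_eq_zero hp (hlim.comp hinj.tendsto_cofinite) (by
    ext m
    have hm := h m
    simp only [hpoly] at hm
    rw [mFourierCoeff_sum_smul_mFourier_mul _ _ _ (hF.integrable (by norm_num))] at hm
    rw [Polynomial.aeval_eq_sum_range, LinearMap.sum_apply, Finset.sum_apply, Pi.zero_apply, ← hm]
    refine Finset.sum_congr rfl fun l _ => ?_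
    rw [LinearMap.smul_apply, Pi.smul_apply, shift_pow_apply, smul_eq_mul, Function.comp_apply,
      Pi.single_sub, add_sub_assoc])
  simpa using congrFun h0 0

/-! ### Polynomials in the sum of the two submodules -/

theorem HasBoundary.add {n : ℕ} {f g : polydisc n → ℂ} {F G : UnitAddTorus (Fin n) → ℂ}
    (hf : IsHolomorphic f) (hg : IsHolomorphic g) (hF : HasBoundary f F) (hG : HasBoundary g G)
    (hF1 : Integrable F (torusMeasure n)) (hG1 : Integrable G (torusMeasure n)) :
    HasBoundary (f + g) fun θ => F θ + G θ := by
  constructor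
  · intro k hk
    rw [mFourierCoeff_add hF1 hG1, hF.coeff_eq_zero k hk, hG.coeff_eq_zero k hk, add_zero]
  · intro r hr k
    have h : ∀ θ, zeroExt (f + g) (torusPoint r θ) =
        zeroExt f (torusPoint r θ) + zeroExt g (torusPoint r θ) := fun θ => by
      simp [zeroExt_apply_of_mem _ (torusPoint_mem hr θ)]
    simp only [h]
    rw [mFourierCoeff_add
      (memLp_one_iff_integrable.1 ((hf.continuous_torus hr).memLp_torus 1))
      (memLp_one_iff_integrable.1 ((hg.continuous_torus hr).memLp_torus 1)),
      mFourierCoeff_add hF1 hG1, hF.coeff_eq r hr, hG.coeff_eq r hr, mul_add]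

theorem IsInner.mul_mem_H2 {n : ℕ} {φ f : polydisc n → ℂ} (hφ : IsInner φ) (hf : f ∈ H2 n) :
    φ * f ∈ H2 n := by
  obtain ⟨Φ, hΦ, -, hφΦ⟩ := hφ.exists_hasBoundary
  obtain ⟨F, hF2, hfF⟩ := exists_hasBoundary_of_mem_H2 hf
  exact ⟨hφ.holomorphic.mul hf.1, hardyMean_lt_top_of_hasBoundary (hφ.holomorphic.mul hf.1)
    (hF2.mul hΦ) (hφΦ.mul hφ.holomorphic hf.1 hfF (hΦ.mono_exponent le_top) hF2)⟩

theorem isHolomorphic_eval_coord {n : ℕ} (i : Fin n) (p : Polynomial ℂ) :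
    IsHolomorphic fun z : polydisc n => p.eval (z.1 i) := by
  have h : Differentiable ℂ fun z : Fin n → ℂ => p.eval (z i) :=
    p.differentiable.comp (differentiable_apply i)
  exact h.differentiableOn.congr fun z hz => zeroExt_apply_of_mem _ hz

theorem continuous_eval_toCircle {n : ℕ} (i : Fin n) (p : Polynomial ℂ) :
    Continuous fun θ : UnitAddTorus (Fin n) => p.eval ((θ i).toCircle : ℂ) :=
  p.continuous.comp (continuous_subtype_val.comp
    (AddCircle.continuous_toCircle.comp (continuous_apply i)))

theorem hasBoundary_eval_coord {n : ℕ} (i : Fin n) (p : Polynomial ℂ) :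
    HasBoundary (fun z : polydisc n => p.eval (z.1 i))
      fun θ => p.eval ((θ i).toCircle : ℂ) := by
  refine HasBoundary.of_radial_limit (isHolomorphic_eval_coord i p)
    (C := ∑ l ∈ Finset.range (p.natDegree + 1), ‖p.coeff l‖) (fun z => ?_)
    (Eventually.of_forall fun θ => ?_)
  · rw [Polynomial.eval_eq_sum_range]
    refine (norm_sum_le _ _).trans (Finset.sum_le_sum fun l _ => ?_)
    rw [norm_mul, norm_pow]
    exact mul_le_of_le_one_right (norm_nonneg _) (pow_le_one₀ (norm_nonneg _) (z.2 i).le)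
  · have h : Continuous fun t : ℝ => p.eval ((t : ℂ) * ((θ i).toCircle : ℂ)) :=
      p.continuous.comp (Complex.continuous_ofReal.mul continuous_const)
    have h1 := h.tendsto 1
    simp only [Complex.ofReal_one, one_mul] at h1
    refine (h1.mono_left nhdsWithin_le_nhds).congr' ?_
    filter_upwards [eventually_mem_Ico_nhdsWithin_one] with t ht
    rw [zeroExt_apply_of_mem _ (torusPoint_mem (fun _ => ht) θ)]
    rfl

theorem eval_coord_mem_H2 {n : ℕ} (i : Fin n) (p : Polynomial ℂ) :
    (fun z : polydisc n => p.eval (z.1 i)) ∈ H2 n :=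
  ⟨isHolomorphic_eval_coord i p, hardyMean_lt_top_of_hasBoundary (isHolomorphic_eval_coord i p)
    ((continuous_eval_toCircle i p).memLp_torus 2) (hasBoundary_eval_coord i p)⟩

/-- A subspace of finite codimension in the Hardy space contains a nonzero polynomial in each of the
coordinates, since the space of such polynomials is infinite-dimensional. -/
theorem exists_eval_coord_mem {n : ℕ} {M : Submodule ℂ (polydisc n → ℂ)}
    (hfin : FiniteDimensional ℂ (H2 n ⧸ M.submoduleOf (H2 n))) (i : Fin n) :
    ∃ p : Polynomial ℂ, p ≠ 0 ∧ (fun z : polydisc n => p.eval (z.1 i)) ∈ M := by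
  let T : Polynomial ℂ →ₗ[ℂ] H2 n :=
    { toFun := fun p => ⟨fun z => p.eval (z.1 i), eval_coord_mem_H2 i p⟩
      map_add' := fun p q => by ext z; simp
      map_smul' := fun a p => by ext z; simp }
  have hker : LinearMap.ker ((M.submoduleOf (H2 n)).mkQ ∘ₗ T) ≠ ⊥ := fun h =>
    Polynomial.not_finite (R := ℂ) (Module.Finite.of_injective _ (LinearMap.ker_eq_bot.1 h))
  obtain ⟨p, hp, hp0⟩ := Submodule.exists_mem_ne_zero_of_ne_bot hker
  refine ⟨p, hp0, ?_⟩
  rw [LinearMap.mem_ker, LinearMap.comp_apply, Submodule.mkQ_apply,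
    Submodule.Quotient.mk_eq_zero] at hp
  exact hp

theorem mem_mulH2 {n : ℕ} {φ f : polydisc n → ℂ} : f ∈ mulH2 φ ↔ ∃ g ∈ H2 n, φ * g = f :=
  Iff.rfl

theorem ae_mul_conj_eq_one {n : ℕ} {Φ : UnitAddTorus (Fin n) → ℂ}
    (hΦ : ∀ᵐ θ ∂torusMeasure n, ‖Φ θ‖ = 1) : ∀ᵐ θ ∂torusMeasure n, Φ θ * conj (Φ θ) = 1 := by
  filter_upwards [hΦ] with θ hθ
  rw [Complex.mul_conj, Complex.normSq_eq_norm_sq, hθ]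
  norm_num

/-- If `p (zᵢ) = φ u + ψ v` and `φ a = ψ b`, then on the torus `p (zᵢ) (a / ψ) = b u + a v`, whose
Fourier coefficients vanish outside `ℕⁿ` although those of `a / ψ` may a priori not. -/
theorem mFourierCoeff_eval_mul_quotient_eq_zero {n : ℕ} {φ ψ a b : polydisc n → ℂ}
    (hφ : IsInner φ) (hψ : IsInner ψ) (ha : a ∈ H2 n) (hb : b ∈ H2 n) (hab : φ * a = ψ * b)
    {Ψ A : UnitAddTorus (Fin n) → ℂ} (hΨ : MemLp Ψ ∞ (torusMeasure n))
    (hΨ1 : ∀ᵐ θ ∂torusMeasure n, ‖Ψ θ‖ = 1) (hψΨ : HasBoundary ψ Ψ)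
    (hA : MemLp A 2 (torusMeasure n)) (haA : HasBoundary a A) {i : Fin n} {p : Polynomial ℂ}
    (hp : (fun z : polydisc n => p.eval (z.1 i)) ∈ mulH2 φ ⊔ mulH2 ψ)
    {k : Fin n → ℤ} (hk : ¬ 0 ≤ k) :
    mFourierCoeff (fun θ => p.eval ((θ i).toCircle : ℂ) * (conj (Ψ θ) * A θ)) k = 0 := by
  obtain ⟨f, hf, g, hg, hfg⟩ := Submodule.mem_sup.1 hp
  obtain ⟨u, hu, rfl⟩ := mem_mulH2.1 hf
  obtain ⟨v, hv, rfl⟩ := mem_mulH2.1 hg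
  obtain ⟨Φ, hΦ, -, hφΦ⟩ := hφ.exists_hasBoundary
  obtain ⟨B, hB, hbB⟩ := exists_hasBoundary_of_mem_H2 hb
  obtain ⟨U, hU, huU⟩ := exists_hasBoundary_of_mem_H2 hu
  obtain ⟨V, hV, hvV⟩ := exists_hasBoundary_of_mem_H2 hv
  have hΦ2 : MemLp Φ 2 (torusMeasure n) := hΦ.mono_exponent le_top
  have hΨ2 : MemLp Ψ 2 (torusMeasure n) := hΨ.mono_exponent le_top
  have hΦA : MemLp (fun θ => Φ θ * A θ) 2 (torusMeasure n) := hA.mul hΦ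
  have hΨB : MemLp (fun θ => Ψ θ * B θ) 2 (torusMeasure n) := hB.mul hΨ
  have hΦU : MemLp (fun θ => Φ θ * U θ) 2 (torusMeasure n) := hU.mul hΦ
  have hΨV : MemLp (fun θ => Ψ θ * V θ) 2 (torusMeasure n) := hV.mul hΨ
  have h1 : (fun θ => Φ θ * A θ) =ᵐ[torusMeasure n] fun θ => Ψ θ * B θ := by
    refine ae_eq_of_mFourierCoeff_eq hΦA hΨB ?_
    have h := hφΦ.mul hφ.holomorphic ha.1 haA hΦ2 hA
    rw [hab] at h
    exact h.mFourierCoeff_unique (hψΨ.mul hψ.holomorphic hb.1 hbB hΨ2 hB)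
  have h2 : (fun θ => Φ θ * U θ + Ψ θ * V θ) =ᵐ[torusMeasure n]
      fun θ => p.eval ((θ i).toCircle : ℂ) := by
    refine ae_eq_of_mFourierCoeff_eq (hΦU.add hΨV)
      ((continuous_eval_toCircle i p).memLp_torus 2) ?_
    have h := (hφΦ.mul hφ.holomorphic hu.1 huU hΦ2 hU).add (hφ.holomorphic.mul hu.1)
      (hψ.holomorphic.mul hv.1) (hψΨ.mul hψ.holomorphic hv.1 hvV hΨ2 hV)
      (hΦU.integrable (by norm_num)) (hΨV.integrable (by norm_num))
    rw [hfg] at h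
    exact h.mFourierCoeff_unique (hasBoundary_eval_coord i p)
  have h3 : (fun θ => p.eval ((θ i).toCircle : ℂ) * (conj (Ψ θ) * A θ)) =ᵐ[torusMeasure n]
      fun θ => B θ * U θ + A θ * V θ := by
    filter_upwards [h1, h2, ae_mul_conj_eq_one hΨ1] with θ e1 e2 e3
    rw [← e2]
    linear_combination U θ * conj (Ψ θ) * e1 + (B θ * U θ + A θ * V θ) * e3
  have hBU : Integrable (fun θ => B θ * U θ) (torusMeasure n) := hB.integrable_mul hU
  have hAV : Integrable (fun θ => A θ * V θ) (torusMeasure n) := hA.integrable_mul hV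
  rw [mFourierCoeff_congr_ae h3, mFourierCoeff_add hBU hAV,
    (hbB.mul hb.1 hu.1 huU hB hU).coeff_eq_zero k hk,
    (haA.mul ha.1 hv.1 hvV hA hV).coeff_eq_zero k hk, add_zero]

end HardyPolydisc

open HardyPolydisc
theorem lemma3p3 (n : ℕ) (hn : 1 < n) (φ ψ : polydisc n → ℂ) (hφ : IsInner φ) (hψ : IsInner ψ)
    (hfin : FiniteDimensional ℂ (H2 n ⧸ (mulH2 φ ⊔ mulH2 ψ).submoduleOf (H2 n))) :
    mulH2 φ ⊓ mulH2 ψ = mulH2 (φ * ψ) := by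
  apply le_antisymm
  · rintro f ⟨hfφ, hfψ⟩
    obtain ⟨a, ha, rfl⟩ := mem_mulH2.1 hfφ
    obtain ⟨b, hb, hab⟩ := mem_mulH2.1 hfψ
    obtain ⟨Ψ, hΨ, hΨ1, hψΨ⟩ := hψ.exists_hasBoundary
    obtain ⟨A, hA, haA⟩ := exists_hasBoundary_of_mem_H2 ha
    have hK : MemLp (fun θ => conj (Ψ θ) * A θ) 2 (torusMeasure n) := hA.mul hΨ.star
    have hK0 : ∀ k, ¬ 0 ≤ k → mFourierCoeff (fun θ => conj (Ψ θ) * A θ) k = 0 := by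
      intro k hk
      obtain ⟨l, hl⟩ : ∃ l, ¬ 0 ≤ k l := by simpa [Pi.le_def] using hk
      -- A coordinate other than `l` exists as `n > 1`; moving in its direction keeps `k l < 0`.
      have : Nontrivial (Fin n) := Fin.nontrivial_iff_two_le.2 hn
      obtain ⟨i, hi⟩ := exists_ne l
      obtain ⟨p, hp0, hp⟩ := exists_eval_coord_mem hfin i
      refine mFourierCoeff_eq_zero_of_polynomial_mul hK hp0 i k fun m => ?_
      refine mFourierCoeff_eval_mul_quotient_eq_zero hφ hψ ha hb hab.symm hΨ hΨ1 hψΨ hA haA hp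
        fun h => hl ?_
      simpa [hi.symm] using h l
    obtain ⟨κ, hκ, hκK⟩ := exists_mem_H2_hasBoundary hK hK0
    have hψκ : ψ * κ = a := by
      refine HasBoundary.eq_of_coeff_eq (hψ.holomorphic.mul hκ.1) ha.1
        (hψΨ.mul hψ.holomorphic hκ.1 hκK (hΨ.mono_exponent le_top) hK) haA fun k => ?_
      refine mFourierCoeff_congr_ae ?_ k
      filter_upwards [ae_mul_conj_eq_one hΨ1] with θ hθ
      rw [← mul_assoc, hθ, one_mul]
    exact mem_mulH2.2 ⟨κ, hκ, by rw [mul_assoc, hψκ]⟩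
  · intro f hf
    obtain ⟨κ, hκ, rfl⟩ := mem_mulH2.1 hf
    exact ⟨mem_mulH2.2 ⟨ψ * κ, hψ.mul_mem_H2 hκ, (mul_assoc _ _ _).symm⟩,
      mem_mulH2.2 ⟨φ * κ, hφ.mul_mem_H2 hκ, by rw [mul_left_comm, mul_assoc]⟩⟩
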